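/- Let $\mu\ge 0$ be an integer and let $g$ be an even entire function of order strictly less than $2$ such that $$z^{-2\mu}g(z)=\sum_{n=0}^{\infty}a_n(-z^2)^n,\qquad a_0a_n>0\quad\text{for all } n\ge 1 .$$ Suppose that the nonzero roots of $g$, listed with multiplicity, are $\pm z_1,\pm z_2,\dots$, and that there is an $M>0$ with $$\operatorname{Re} z_n>0,\qquad \operatorname{Re}(z_n^2)>1,\qquad |\operatorname{Im} z_n|\le M\qquad\text{for all } n\ge 1 .$$ Put $h(z)=\sum_{n\ge 0}a_n(-z^2)^n$ (so $g(z)=z^{2\mu}h(z)$, and $h=g$ if $\mu=0$) and, for $k\ge 0$, $$m_k=-\frac{1}{2\,(2k+3)!}\left(\frac{h'}{h}\right)^{(2k+3)}(0).$$ Then, for all $k\ge0$ (and $n\ge 0$), the following series converge and, with $\Delta m_n=m_{n+1}-m_n$, $$m_k=\sum_{j=1}^{\infty}\frac{1}{z_j^{2k+4}},\qquad (-1)^k\Delta^k m_n=\sum_{j=1}^{\infty}\frac{1}{z_j^{2n+4}}\left(1-\frac{1}{z_j^{2}}\right)^k ,$$ and all the nonzero roots of $g$ are real if and only if $$(-1)^k\Delta^k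 m_n\ge 0\qquad\text{for all integers } n,k\ge 0$$ (that is, each of these numbers is real and nonnegative). -/

import Mathlib

open scoped ComplexOrder ENNReal NNReal

/-- The order of growth of an entire function: the infimum of all `ρ ≥ 0` such that
`f(z) = O(exp(|z|^ρ))` as `|z| → ∞` (it is `∞` if there is no such `ρ`). -/
noncomputable def entireOrder (f : ℂ → ℂ) : ℝ≥0∞ :=
  ⨅ (ρ : ℝ≥0) (_ : f =O[Bornology.cobounded ℂ] fun z : ℂ => Real.exp (‖z‖ ^ (ρ : ℝ))), (ρ : ℝ≥0∞)

/-- `±z_0, ±z_1, …` lists the nonzero roots of `g`, each as often as its multiplicity says. -/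
def ListsNonzeroRoots (g : ℂ → ℂ) (z : ℕ → ℂ) : Prop :=
  ∀ w : ℂ, w ≠ 0 →
    analyticOrderAt g w = Set.encard {n : ℕ | z n = w} + Set.encard {n : ℕ | -z n = w}

/-- The function `∑ a_n (-z²)^n`. -/
noncomputable def evenSeries (a : ℕ → ℂ) (z : ℂ) : ℂ :=
  ∑' n : ℕ, a n * (-z ^ 2) ^ n

/-- `-1 / ((2k+3)! · 2)` times the `(2k+3)`-rd derivative of `h'/h` at `0`. -/
noncomputable def logDerivMoment (h : ℂ → ℂ) (k : ℕ) : ℂ :=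
  -(1 / (((2 * k + 3).factorial : ℂ) * 2)) * iteratedDeriv (2 * k + 3) (logDeriv h) 0

/-- The Hausdorff conditions `(-1)^k Δ^k m_n ≥ 0` with `Δ m_n = m_{n+1} - m_n`. The relation `0 ≤ w`
in `ℂ` says that `w` is real and nonnegative. -/
def HausdorffConditions (m : ℕ → ℂ) : Prop :=
  ∀ n k : ℕ, 0 ≤ (-1) ^ k * (fwdDiff (1 : ℕ))^[k] m n

/-! Moment formulas: divide `h` by the factors 1 - w²/z_j² with |z_j| ≤ R. The quotient has no zero
in the disc of radius R, and on |w| = 2R each factor has modulus at least 1, so the maximum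
principle bounds the quotient by the growth of `h`. Borel–Carathéodory makes its logarithmic Taylor
coefficients of degree 2k+2 at most O(R^ρ / R^(2k+2)), up to constants, which tends to 0 because ρ <
2. Hence the power sums over discs converge to the coefficients for `h`, with no Hadamard product.
The strip condition makes ∑ 1/z_j² absolutely convergent.

Reality: put x_j = 1/z_j², so |x_j| ≤ 1 and Re x_j > 0. The conditions say that L(q) = ∑ x_j² q(x_j)
is nonnegative on every X^n (1-X)^k. Real x_j lie in (0,1], so each term is then nonnegative.
Conversely, let x_i = a + ib with b ≠ 0. The polynomial p = 1 - (X-a)² equals 1 + b² at x_i, yet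
positivity gives L(r p^N) = O(A^N) for some A < 1 + b². Choosing r to vanish at the finitely many
other x_j away from 0, while |p| ≤ 1 near 0, makes L(r p^N) grow like (1+b²)^N: a contradiction
(`SquareWeightedSum.im_eq_zero`). -/

open Metric in
/-- The Borel–Carathéodory bound for the Taylor coefficients of the logarithmic derivative of a
zero-free function. -/
theorem norm_iteratedDeriv_logDeriv_le {f : ℂ → ℂ} {A R : ℝ} (hA : 0 < A) (hR : 0 < R)
    (hf : DifferentiableOn ℂ f (ball 0 R)) (h0 : ∀ z ∈ ball (0 : ℂ) R, f z ≠ 0)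
    (hb : ∀ z ∈ ball (0 : ℂ) R, ‖f z‖ ≤ Real.exp A * ‖f 0‖) (n : ℕ) :
    ‖iteratedDeriv n (logDeriv f) 0‖ ≤ (n + 1).factorial * (2 * A) / (R / 2) ^ (n + 1) := by
  have h0R : (0 : ℂ) ∈ ball (0 : ℂ) R := mem_ball_self hR
  have hlog : DifferentiableOn ℂ (logDeriv f) (ball 0 R) :=
    (hf.deriv isOpen_ball).div hf h0
  -- `q` is the branch of log (f / f 0) that vanishes at 0.
  obtain ⟨q, hq0, hq⟩ := hlog.isExactOn_ball.with_val_at 0 0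
  have hqd : DifferentiableOn ℂ q (ball 0 R) := fun z hz =>
    (hq z hz).differentiableAt.differentiableWithinAt
  have hexp : ∀ z ∈ ball (0 : ℂ) R, f z * Complex.exp (-q z) = f 0 := by
    intro z hz
    have hd : ∀ w ∈ ball (0 : ℂ) R, HasDerivAt (fun w => f w * Complex.exp (-q w)) 0 w := by
      intro w hw
      have h1 := (hf.differentiableAt (isOpen_ball.mem_nhds hw)).hasDerivAt
      have h2 := h1.fun_mul (hq w hw).fun_neg.cexp
      have h3 : deriv f w * Complex.exp (-q w) +
          f w * (Complex.exp (-q w) * -logDeriv f w) = 0 := by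
        rw [logDeriv_apply]
        field_simp [h0 w hw]
        ring
      rwa [h3] at h2
    have := isOpen_ball.is_const_of_deriv_eq_zero (convex_ball (0 : ℂ) R).isPreconnected
      (fun w hw => (hd w hw).differentiableAt.differentiableWithinAt)
      (fun w hw => (hd w hw).deriv) hz h0R
    simpa [hq0] using this
  have hre : Set.MapsTo q (ball 0 R) {z | z.re ≤ A} := by
    intro z hz
    have h1 : ‖f z‖ * Real.exp (-(q z).re) = ‖f 0‖ := by
      rw [← hexp z hz, norm_mul, Complex.norm_exp, Complex.neg_re]
    have h2 : ‖f z‖ = Real.exp (q z).re * ‖f 0‖ := by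
      rw [← h1, mul_left_comm, ← Real.exp_add]; simp
    have h3 := hb z hz
    rw [h2] at h3
    exact Real.exp_le_exp.1 (le_of_mul_le_mul_right h3 (norm_pos_iff.2 (h0 0 h0R)))
  have hbc : ∀ z ∈ sphere (0 : ℂ) (R / 2), ‖q z‖ ≤ 2 * A := by
    intro z hz
    have hz' : ‖z‖ = R / 2 := by simpa using hz
    have := Complex.borelCaratheodory_zero hA hqd hre hR (z := z)
      (by rw [mem_ball_zero_iff, hz']; linarith) hq0
    rw [hz'] at this
    refine this.trans_eq ?_
    field_simp
    ring
  have hev : deriv q =ᶠ[nhds 0] logDeriv f := by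
    filter_upwards [isOpen_ball.mem_nhds h0R] with w hw using (hq w hw).deriv
  have := Complex.norm_iteratedDeriv_le_of_forall_mem_sphere_norm_le (f := q) (c := 0) (n + 1)
    (half_pos hR) ((hqd.mono (closedBall_subset_ball (by linarith))).diffContOnCl_ball
      subset_rfl) hbc
  rwa [iteratedDeriv_succ', hev.iteratedDeriv_eq] at this

/-! ### Dividing out pairs of roots -/

/-- The quadratic factor with roots `± c`. -/
noncomputable def rootFactor (c w : ℂ) : ℂ := (1 - w / c) * (1 + w / c)

theorem differentiable_rootFactor (c : ℂ) : Differentiable ℂ (rootFactor c) := by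
  unfold rootFactor; fun_prop

theorem analyticOrderAt_one_sub_div {c : ℂ} (hc : c ≠ 0) (w : ℂ) :
    analyticOrderAt (fun w : ℂ => 1 - w / c) w = if c = w then 1 else 0 := by
  have ha : AnalyticAt ℂ (fun w : ℂ => 1 - w / c) w := by fun_prop
  split_ifs with h
  · subst h
    refine ha.analyticOrderAt_eq_one_of_zero_deriv_ne_zero (by simp [hc]) ?_
    simp [hc]
  · rw [ha.analyticOrderAt_eq_zero, sub_ne_zero, Ne, eq_comm, div_eq_one_iff_eq hc]
    exact fun h' => h h'.symm

theorem analyticOrderAt_rootFactor {c : ℂ} (hc : c ≠ 0) (w : ℂ) :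
    analyticOrderAt (rootFactor c) w = (if c = w then 1 else 0) + (if -c = w then 1 else 0) := by
  have h1 := analyticOrderAt_one_sub_div hc w
  have h2 := analyticOrderAt_one_sub_div (neg_ne_zero.2 hc) w
  have h3 : rootFactor c = (fun w : ℂ => 1 - w / c) * (fun w : ℂ => 1 - w / (-c)) := by
    ext w; simp [rootFactor, div_neg]
  rw [h3, analyticOrderAt_mul (by fun_prop) (by fun_prop), h1, h2]

theorem analyticOrderAt_prod_rootFactor {ι : Type*} {z : ι → ℂ} (hz : ∀ i, z i ≠ 0)
    (S : Finset ι) (w : ℂ) :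
    analyticOrderAt (fun u => ∏ j ∈ S, rootFactor (z j) u) w =
      Set.encard {n ∈ (S : Set ι) | z n = w} + Set.encard {n ∈ (S : Set ι) | -z n = w} := by
  classical
  induction S using Finset.induction_on with
  | empty =>
    have : AnalyticAt ℂ (fun _ : ℂ => (1 : ℂ)) w := by fun_prop
    simpa using this.analyticOrderAt_eq_zero.2 one_ne_zero
  | insert j S hj ih =>
    have h3 : (fun u => ∏ i ∈ insert j S, rootFactor (z i) u) =
        rootFactor (z j) * fun u => ∏ i ∈ S, rootFactor (z i) u := by
      ext u; simp [Finset.prod_insert hj]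
    have key : ∀ f : ι → ℂ, Set.encard {n ∈ ((insert j S : Finset ι) : Set ι) | f n = w} =
        (if f j = w then 1 else 0) + Set.encard {n ∈ (S : Set ι) | f n = w} := by
      intro f
      split_ifs with h
      · have : {n ∈ ((insert j S : Finset ι) : Set ι) | f n = w} =
            insert j {n ∈ (S : Set ι) | f n = w} := by
          ext n; simp only [Finset.coe_insert, Set.mem_insert_iff, Set.mem_sep_iff]; grind
        rw [this, Set.encard_insert_of_notMem (by simp [hj]), add_comm]
      · have : {n ∈ ((insert j S : Finset ι) : Set ι) | f n = w} =
            {n ∈ (S : Set ι) | f n = w} := by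
          ext n; simp only [Finset.coe_insert, Set.mem_insert_iff, Set.mem_sep_iff]; grind
        rw [this, zero_add]
    rw [h3, analyticOrderAt_mul ((differentiable_rootFactor _).analyticAt _)
      ((Differentiable.fun_finsetProd fun i _ => differentiable_rootFactor _).analyticAt _), ih,
      analyticOrderAt_rootFactor (hz j), key z, key fun n => -z n]
    ring

/-- An entire function can be divided by a linear polynomial vanishing at one of its roots. -/
theorem Differentiable.exists_eq_one_sub_div_mul {f : ℂ → ℂ} (hf : Differentiable ℂ f) {c : ℂ}
    (hc : c ≠ 0) (h : f c = 0) :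
    ∃ q : ℂ → ℂ, Differentiable ℂ q ∧ ∀ w, f w = (1 - w / c) * q w := by
  refine ⟨fun w => -c * dslope f c w, ?_, fun w => ?_⟩
  · refine Differentiable.const_mul ?_ _
    rw [← differentiableOn_univ, Complex.differentiableOn_dslope Filter.univ_mem]
    exact hf.differentiableOn
  · have := sub_smul_dslope f c w
    rw [h, sub_zero, smul_eq_mul] at this
    rw [← this]
    field_simp
    ring

/-- Since `j ∉ S`, the factors already removed do not exhaust the multiplicity of `h` at ± z j, so
the quotient still vanishes at both points and the next pair can be divided out. -/
theorem exists_eq_mul_prod_rootFactor {ι : Type*} {h : ℂ → ℂ} {z : ι → ℂ}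
    (hh : Differentiable ℂ h) (hz : ∀ i, z i ≠ 0)
    (hord : ∀ w : ℂ, w ≠ 0 →
      analyticOrderAt h w = Set.encard {n | z n = w} + Set.encard {n | -z n = w})
    (S : Finset ι) :
    ∃ f : ℂ → ℂ, Differentiable ℂ f ∧ ∀ w, h w = f w * ∏ j ∈ S, rootFactor (z j) w := by
  classical
  induction S using Finset.induction_on with
  | empty => exact ⟨h, hh, by simp⟩
  | insert j S hj ih =>
    obtain ⟨f, hf, hfh⟩ := ih
    have hlt : ∀ (u : ι → ℂ), (Set.encard {n ∈ (S : Set ι) | u n = u j}) + 1 ≤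
        Set.encard {n | u n = u j} := by
      intro u
      rw [← Set.encard_insert_of_notMem (a := j) (by simp [hj])]
      refine Set.encard_le_encard ?_
      intro n hn
      rcases hn with rfl | hn
      · rfl
      · exact hn.2
    have hP := fun w => analyticOrderAt_prod_rootFactor hz S w
    have hmul : ∀ w, analyticOrderAt h w = analyticOrderAt f w +
        analyticOrderAt (fun u => ∏ j ∈ S, rootFactor (z j) u) w := by
      intro w
      rw [← analyticOrderAt_mul (hf.analyticAt _)
        ((Differentiable.fun_finsetProd fun i _ => differentiable_rootFactor _).analyticAt _)]
      congr 1
      ext w; exact hfh w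
    have hfin : ∀ u : ι → ℂ, ∀ w, (Set.encard {n ∈ (S : Set ι) | u n = w}) ≠ ⊤ := by
      intro u w
      rw [Set.encard_ne_top_iff]
      exact S.finite_toSet.subset fun n hn => hn.1
    have hzero : ∀ w, w ≠ 0 → (Set.encard {n ∈ (S : Set ι) | z n = w} +
        Set.encard {n ∈ (S : Set ι) | -z n = w} + 1 ≤
        Set.encard {n | z n = w} + Set.encard {n | -z n = w}) → f w = 0 := by
      intro w hw hle
      rw [← hord w hw, hmul, hP] at hle
      by_contra hne
      rw [(hf.analyticAt w).analyticOrderAt_eq_zero.2 hne, zero_add] at hle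
      rw [ENat.add_one_le_iff] at hle
      · exact lt_irrefl _ hle
      · exact WithTop.add_ne_top.2 ⟨hfin z w, hfin (fun n => -z n) w⟩
    have hmono : ∀ (u : ι → ℂ) (w : ℂ), (Set.encard {n ∈ (S : Set ι) | u n = w}) ≤
        Set.encard {n | u n = w} := fun u w => Set.encard_le_encard fun n hn => hn.2
    have hf1 : f (z j) = 0 := by
      refine hzero _ (hz j) ?_
      rw [add_right_comm]
      exact add_le_add (hlt z) (hmono (fun n => -z n) _)
    have hf2 : f (-z j) = 0 := by
      refine hzero _ (neg_ne_zero.2 (hz j)) ?_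
      rw [add_assoc]
      exact add_le_add (hmono z _) (hlt fun n => -z n)
    obtain ⟨f1, hd1, he1⟩ := hf.exists_eq_one_sub_div_mul (hz j) hf1
    have hf3 : f1 (-z j) = 0 := by
      rw [he1, neg_div, div_self (hz j)] at hf2
      simpa [show (1 : ℂ) + 1 ≠ 0 by norm_num] using hf2
    obtain ⟨f2, hd2, he2⟩ := hd1.exists_eq_one_sub_div_mul (neg_ne_zero.2 (hz j)) hf3
    refine ⟨f2, hd2, fun w => ?_⟩
    rw [hfh, he1, he2, Finset.prod_insert hj, rootFactor, div_neg]
    ring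

/-- Near 0 the logarithmic derivative is 1/(w-c) + 1/(w+c); in odd order the two poles contribute
equally at 0. -/
theorem iteratedDeriv_logDeriv_rootFactor {c : ℂ} (hc : c ≠ 0) (k : ℕ) :
    iteratedDeriv (2 * k + 1) (logDeriv (rootFactor c)) 0 =
      -(2 * (2 * k + 1).factorial) * (1 / c ^ (2 * k + 2)) := by
  have hev : logDeriv (rootFactor c) =ᶠ[nhds 0]
      (fun w => (1 * w - c)⁻¹ + (1 * w + c)⁻¹) := by
    filter_upwards [isOpen_ne.mem_nhds hc.symm, isOpen_ne.mem_nhds (neg_ne_zero.2 hc).symm]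
      with w h1 h2
    have h1' : w - c ≠ 0 := sub_ne_zero.2 h1
    have h2' : w + c ≠ 0 := by rw [← sub_neg_eq_add]; exact sub_ne_zero.2 h2
    have hd : HasDerivAt (rootFactor c) ((-(1 / c)) * (1 + w / c) + (1 - w / c) * (1 / c)) w :=
      (((hasDerivAt_id w).div_const c).const_sub 1).mul (((hasDerivAt_id w).div_const c).const_add 1)
    have h1'' : 1 - w / c = -(w - c) / c := by field_simp; ring
    have h2'' : 1 + w / c = (w + c) / c := by field_simp; ring
    rw [logDeriv_apply, hd.deriv, rootFactor, h1'', h2'']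
    field_simp
    ring
  have e1 : ContDiffAt ℂ ((2 * k + 1 : ℕ)) (fun w : ℂ => (1 * w - c)⁻¹) 0 :=
    ContDiffAt.inv (by fun_prop) (by simpa using hc)
  have e2 : ContDiffAt ℂ ((2 * k + 1 : ℕ)) (fun w : ℂ => (1 * w + c)⁻¹) 0 :=
    ContDiffAt.inv (by fun_prop) (by simpa using hc)
  rw [hev.iteratedDeriv_eq, iteratedDeriv_fun_add e1 e2, iteratedDeriv_eq_iterate,
    iteratedDeriv_eq_iterate, iter_deriv_inv_linear, iter_deriv_inv_linear_sub]
  have hexp : (-1 - ((2 * k + 1 : ℕ) : ℤ)) = -((2 * k + 2 : ℕ) : ℤ) := by push_cast; ring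
  simp only [hexp, zpow_neg, zpow_natCast, mul_zero, zero_sub, zero_add, one_pow, mul_one]
  rw [Even.neg_pow (n := 2 * k + 2) ⟨k + 1, by ring⟩ c, Odd.neg_one_pow ⟨k, rfl⟩]
  field_simp
  ring

/-! ### A positivity cone of polynomials on the unit interval -/

open Polynomial in
/-- The cone of real polynomials generated by the `X ^ i * (1 - X) ^ j`. -/
noncomputable def bernsteinCone : Subalgebra ℝ≥0 ℝ[X] := Algebra.adjoin ℝ≥0 {X, 1 - X}

namespace bernsteinCone
open Polynomial

theorem X_mem : X ∈ bernsteinCone := Algebra.subset_adjoin (by simp)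

theorem one_sub_X_mem : 1 - X ∈ bernsteinCone := Algebra.subset_adjoin (by simp)

theorem C_mem {c : ℝ} (hc : 0 ≤ c) : C c ∈ bernsteinCone :=
  bernsteinCone.algebraMap_mem ⟨c, hc⟩

theorem C_mul_mem {c : ℝ} (hc : 0 ≤ c) {p : ℝ[X]} (hp : p ∈ bernsteinCone) :
    C c * p ∈ bernsteinCone := mul_mem (C_mem hc) hp

theorem induction_nonneg {L : ℝ[X] →ₗ[ℝ] ℂ} (hL : ∀ n k : ℕ, 0 ≤ L (X ^ n * (1 - X) ^ k))
    {p : ℝ[X]} (hp : p ∈ bernsteinCone) : 0 ≤ L p := by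
  rw [bernsteinCone, ← Subalgebra.mem_toSubmodule, Algebra.adjoin_eq_span] at hp
  induction hp using Submodule.span_induction with
  | mem x hx =>
    obtain ⟨m, n, rfl⟩ := (Submonoid.mem_closure_pair _ _ _).1 hx
    exact hL m n
  | zero => simp
  | add x y _ _ hx hy =>
    rw [map_add]
    exact add_nonneg hx hy
  | smul c x _ hx =>
    have : L (c • x) = ((c : ℝ) : ℂ) * L x := by
      rw [NNReal.smul_def, map_smul, Complex.real_smul]
    rw [this]
    exact mul_nonneg (by simp) hx

/-- `p` lies between `-A` and `A` in the order given by `bernsteinCone`. -/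
def Bounded (A : ℝ) (p : ℝ[X]) : Prop := C A - p ∈ bernsteinCone ∧ C A + p ∈ bernsteinCone

/-- Rests on 2(AB - pq) = (A-p)(B+q) + (A+p)(B-q) and its analogue with -q for q. -/
theorem Bounded.mul {A B : ℝ} {p q : ℝ[X]} (hp : Bounded A p) (hq : Bounded B q) :
    Bounded (A * B) (p * q) := by
  have h2 : (0 : ℝ) ≤ 1 / 2 := by norm_num
  have hC : (C (1 / 2) : ℝ[X]) * 2 = 1 := by
    rw [show (2 : ℝ[X]) = C 2 from rfl, ← C_mul]; norm_num
  constructor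
  · have : C (A * B) - p * q = C (1 / 2) * ((C A - p) * (C B + q) + (C A + p) * (C B - q)) := by
      rw [C_mul]; linear_combination (-(C A * C B) + p * q) * hC
    rw [this]
    exact C_mul_mem h2 (add_mem (mul_mem hp.1 hq.2) (mul_mem hp.2 hq.1))
  · have : C (A * B) + p * q = C (1 / 2) * ((C A - p) * (C B - q) + (C A + p) * (C B + q)) := by
      rw [C_mul]; linear_combination (-(C A * C B) - p * q) * hC
    rw [this]
    exact C_mul_mem h2 (add_mem (mul_mem hp.1 hq.1) (mul_mem hp.2 hq.2))

theorem bounded_one : Bounded 1 1 := by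
  constructor
  · simp [zero_mem]
  · simpa using add_mem (one_mem bernsteinCone) (one_mem bernsteinCone)

theorem Bounded.pow {A : ℝ} {p : ℝ[X]} (hp : Bounded A p) (n : ℕ) : Bounded (A ^ n) (p ^ n) := by
  induction n with
  | zero => simpa using bounded_one
  | succ n ih => rw [pow_succ, pow_succ]; exact ih.mul hp

theorem bounded_X : Bounded 1 X :=
  ⟨by simpa using one_sub_X_mem, by simpa using add_mem (one_mem bernsteinCone) X_mem⟩

/-- Positivity of L(A ± p) and L(1) forces L(p) to be real, between ± A L(1). -/
theorem Bounded.norm_le {L : ℝ[X] →ₗ[ℝ] ℂ} (hL : ∀ n k : ℕ, 0 ≤ L (X ^ n * (1 - X) ^ k))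
    {A : ℝ} {p : ℝ[X]} (hp : Bounded A p) : ‖L p‖ ≤ A * ‖L 1‖ := by
  have h1 := induction_nonneg hL hp.1
  have h2 := induction_nonneg hL hp.2
  have h3 := induction_nonneg hL (one_mem bernsteinCone)
  have hC : L (C A) = (A : ℂ) * L 1 := by
    rw [← mul_one (C A), ← smul_eq_C_mul, map_smul, Complex.real_smul]
  rw [map_sub, hC] at h1
  rw [map_add, hC] at h2
  rw [Complex.le_def] at h1 h2 h3
  simp only [Complex.zero_re, Complex.zero_im, Complex.sub_re, Complex.sub_im, Complex.add_re,
    Complex.add_im, Complex.mul_re, Complex.mul_im, Complex.ofReal_re, Complex.ofReal_im,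
    zero_mul, sub_zero, add_zero] at h1 h2 h3
  have e1 : L 1 = ((L 1).re : ℂ) := Complex.ext (by simp) (by simp [← h3.2])
  have e2 : L p = ((L p).re : ℂ) := Complex.ext (by simp) (by
    have := h1.2; rw [← h3.2] at this; simp; linarith)
  rw [e1, e2, Complex.norm_real, Complex.norm_real, Real.norm_of_nonneg h3.1, Real.norm_eq_abs,
    abs_le]
  exact ⟨by linarith [h2.1], by linarith [h1.1]⟩

/-- The parabola `1 - (X - a)²` is bounded by constants arbitrarily close to `1`. -/
theorem bounded_one_sub_sq {a : ℝ} (ha0 : 0 ≤ a) (ha1 : a ≤ 1) {n : ℕ} (hn : 0 < n) :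
    Bounded (1 + 1 / n) (1 - (X - C a) ^ 2) := by
  have hn' : (n : ℝ) ≠ 0 := by positivity
  have hn0 : (0 : ℝ) ≤ 1 / n := by positivity
  constructor
  · have hv := bernsteinPolynomial.variance ℝ n
    have h0 := bernsteinPolynomial.sum ℝ n
    have h1 := bernsteinPolynomial.sum_smul ℝ n
    have hB : ∀ ν, bernsteinPolynomial ℝ n ν ∈ bernsteinCone := by
      intro ν
      rw [bernsteinPolynomial]
      exact mul_mem (mul_mem (natCast_mem _ _) (pow_mem X_mem _)) (pow_mem one_sub_X_mem _)
    have hi : (C (1 / (n : ℝ)) : ℝ[X]) * n = 1 := by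
      rw [← C_eq_natCast, ← C_mul, one_div_mul_cancel hn', C_1]
    -- The Bernstein operator applied to (t-a)². For 0 < a < 1 the square (X-a)² is not in the cone,
    -- as it vanishes inside the interval; the variance term X(1-X)/n repairs this.
    have key : ∑ ν ∈ Finset.range (n + 1), C (((ν : ℝ) / n - a) ^ 2) * bernsteinPolynomial ℝ n ν =
        (X - C a) ^ 2 + C (1 / (n : ℝ)) * (X * (1 - X)) := by
      have : ∀ ν : ℕ, C (((ν : ℝ) / n - a) ^ 2) * bernsteinPolynomial ℝ n ν =
          C (1 / (n : ℝ)) ^ 2 * ((n • X - (ν : ℝ[X])) ^ 2 * bernsteinPolynomial ℝ n ν) +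
          C (1 / (n : ℝ)) * (2 * (X - C a)) * (ν • bernsteinPolynomial ℝ n ν) +
          (C a ^ 2 - X ^ 2) * bernsteinPolynomial ℝ n ν := by
        intro ν
        have : (C (((ν : ℝ) / n - a) ^ 2) : ℝ[X]) = (C (1 / (n : ℝ)) * (ν : ℝ[X]) - C a) ^ 2 := by
          rw [← C_eq_natCast, ← C_mul, ← C_sub, ← C_pow]; congr 2; ring
        rw [this, nsmul_eq_mul, nsmul_eq_mul]
        generalize C (1 / (n : ℝ)) = c at hi
        linear_combination (-(X : ℝ[X]) ^ 2 * (c * n + 1) + 2 * X * c * ν) * bernsteinPolynomial ℝ n ν * hi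
      rw [Finset.sum_congr rfl fun ν _ => this ν, Finset.sum_add_distrib, Finset.sum_add_distrib,
        ← Finset.mul_sum, ← Finset.mul_sum, ← Finset.mul_sum, hv, h0, h1, nsmul_eq_mul]
      generalize C (1 / (n : ℝ)) = c at hi
      linear_combination (c * X * (1 - X) + 2 * (X - C a) * X) * hi
    have : C (1 + 1 / (n : ℝ)) - (1 - (X - C a) ^ 2) =
        ∑ ν ∈ Finset.range (n + 1), C (((ν : ℝ) / n - a) ^ 2) * bernsteinPolynomial ℝ n ν +
          C (1 / (n : ℝ)) * ((1 - X) + X ^ 2) := by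
      rw [key, C_add, C_1]; ring
    rw [this]
    exact add_mem (sum_mem fun ν _ => C_mul_mem (sq_nonneg _) (hB ν))
      (C_mul_mem hn0 (add_mem one_sub_X_mem (pow_mem X_mem 2)))
  -- The parabola itself is in the cone: it factors as (a + (1-X)) ((1-a) + X).
  · have : C (1 + 1 / (n : ℝ)) + (1 - (X - C a) ^ 2) =
        C (1 + 1 / (n : ℝ)) + (C a + (1 - X)) * (C (1 - a) + X) := by
      rw [C_sub, C_1]; ring
    rw [this]
    exact add_mem (C_mem (by positivity)) (mul_mem (add_mem (C_mem ha0) one_sub_X_mem)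
      (add_mem (C_mem (by linarith)) X_mem))

end bernsteinCone

/-! ### The moment functional and the reality of its nodes -/

namespace SquareWeightedSum
open Polynomial

theorem exists_norm_eval_le (q : ℂ[X]) : ∃ B, 0 ≤ B ∧ ∀ y : ℂ, ‖y‖ ≤ 1 → ‖q.eval y‖ ≤ B := by
  obtain ⟨B, hB⟩ := (isCompact_closedBall (0 : ℂ) 1).exists_bound_of_continuousOn
    q.continuous.continuousOn
  exact ⟨B, (norm_nonneg _).trans (hB 0 (by simp)), fun y hy => hB y (by simpa using hy)⟩

variable {x : ℕ → ℂ}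

theorem summable_norm_sq (hs : Summable x) (hx : ∀ j, ‖x j‖ ≤ 1) :
    Summable fun j => ‖x j‖ ^ 2 := by
  refine Summable.of_nonneg_of_le (fun j => by positivity) (fun j => ?_) hs.norm
  rw [pow_two]
  exact mul_le_of_le_one_left (norm_nonneg _) (hx j)

theorem summable_eval (hs : Summable x) (hx : ∀ j, ‖x j‖ ≤ 1) (q : ℂ[X]) :
    Summable fun j => x j ^ 2 * q.eval (x j) := by
  obtain ⟨B, -, hB⟩ := exists_norm_eval_le q
  refine Summable.of_norm_bounded ((summable_norm_sq hs hx).mul_right B) fun j => ?_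
  rw [norm_mul, norm_pow]
  exact mul_le_mul_of_nonneg_left (hB _ (hx j)) (by positivity)

/-- The functional `q ↦ ∑ x_j² q(x_j)` on polynomials. -/
noncomputable def functional (hs : Summable x) (hx : ∀ j, ‖x j‖ ≤ 1) : ℂ[X] →ₗ[ℂ] ℂ where
  toFun q := ∑' j, x j ^ 2 * q.eval (x j)
  map_add' p q := by
    simp only [eval_add, mul_add]
    exact (summable_eval hs hx p).tsum_add (summable_eval hs hx q)
  map_smul' c q := by
    simp only [eval_smul, smul_eq_mul, RingHom.id_apply, mul_left_comm _ c, tsum_mul_left]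

theorem functional_apply (hs : Summable x) (hx : ∀ j, ‖x j‖ ≤ 1) (q : ℂ[X]) :
    functional hs hx q = ∑' j, x j ^ 2 * q.eval (x j) := rfl

/-- The cone only bounds real polynomials, so `r` is split into monomials c X^k; as X is bounded by
1, the bound for X^k p^N is uniform in k, and the constant is independent of N. -/
theorem exists_norm_functional_mul_pow_le (hs : Summable x) (hx : ∀ j, ‖x j‖ ≤ 1)
    (hpos : ∀ n k : ℕ, 0 ≤ functional hs hx (X ^ n * (1 - X) ^ k))
    {A : ℝ} {p : ℝ[X]} (hp : bernsteinCone.Bounded A p) (r : ℂ[X]) :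
    ∃ C, 0 ≤ C ∧ ∀ N : ℕ, ‖functional hs hx (r * mapAlg ℝ ℂ p ^ N)‖ ≤ C * A ^ N := by
  induction r using Polynomial.induction_on' with
  | add r s hr hs' =>
    obtain ⟨C, hC0, hC⟩ := hr
    obtain ⟨D, hD0, hD⟩ := hs'
    refine ⟨C + D, by positivity, fun N => ?_⟩
    rw [add_mul, map_add, add_mul]
    exact (norm_add_le _ _).trans (add_le_add (hC N) (hD N))
  | monomial k c =>
    let L : ℝ[X] →ₗ[ℝ] ℂ := (functional hs hx).restrictScalars ℝ ∘ₗ (mapAlg ℝ ℂ).toLinearMap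
    have hL : ∀ q, L q = functional hs hx (mapAlg ℝ ℂ q) := fun q => rfl
    have hLpos : ∀ n k : ℕ, 0 ≤ L (X ^ n * (1 - X) ^ k) := by
      intro n k
      rw [hL]
      simpa [mapAlg_eq_map] using hpos n k
    refine ⟨‖c‖ * ‖L 1‖, by positivity, fun N => ?_⟩
    have h1 := ((bernsteinCone.bounded_X.pow k).mul (hp.pow N)).norm_le hLpos
    have h2 : monomial k c * mapAlg ℝ ℂ p ^ N = c • mapAlg ℝ ℂ (X ^ k * p ^ N) := by
      rw [map_mul, map_pow, map_pow, ← C_mul_X_pow_eq_monomial, smul_eq_C_mul]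
      simp [mapAlg_eq_map, mul_assoc]
    rw [h2, map_smul, ← hL, smul_eq_mul, norm_mul]
    calc ‖c‖ * ‖L (X ^ k * p ^ N)‖ ≤ ‖c‖ * (1 ^ k * A ^ N * ‖L 1‖) := by gcongr
      _ = _ := by ring

/-- Points of the right half of the unit disc that carry a Hausdorff moment sequence with square
weights are real. -/
theorem im_eq_zero (hs : Summable x) (hx : ∀ j, ‖x j‖ ≤ 1) (hre : ∀ j, 0 < (x j).re)
    (hpos : ∀ n k : ℕ, 0 ≤ ∑' j, x j ^ (n + 2) * (1 - x j) ^ k) (i : ℕ) : (x i).im = 0 := by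
  by_contra hb
  have hpos' : ∀ n k : ℕ, 0 ≤ functional hs hx (X ^ n * (1 - X) ^ k) := by
    intro n k
    rw [functional_apply]
    convert hpos n k using 3 with j
    simp; ring
  set a := (x i).re with ha
  set b := (x i).im with hbdef
  have ha1 : a ≤ 1 := (Complex.re_le_norm _).trans (hx i)
  have hb2 : 0 < b ^ 2 := by positivity
  obtain ⟨n, hn⟩ := exists_nat_one_div_lt hb2
  have hbd := bernsteinCone.bounded_one_sub_sq (hre i).le ha1 n.succ_pos
  set p : ℝ[X] := 1 - (X - C a) ^ 2 with hp
  set A : ℝ := 1 + 1 / ((n.succ : ℕ) : ℝ) with hA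
  have hAb : A < 1 + b ^ 2 := by rw [hA]; push_cast; linarith
  have hA1 : 1 ≤ A := le_add_of_nonneg_right (by positivity)
  have hpe : ∀ y : ℂ, (mapAlg ℝ ℂ p).eval y = 1 - (y - a) ^ 2 := by
    intro y; simp [hp, mapAlg_eq_map]
  have hpi : 1 - (x i - a) ^ 2 = ((1 + b ^ 2 : ℝ) : ℂ) := by
    have : x i - a = b * Complex.I := by
      rw [ha, hbdef]; nth_rewrite 1 [← Complex.re_add_im (x i)]; ring
    rw [this, mul_pow, Complex.I_sq]; push_cast; ring
  -- At 0 the value is 1 - a², of modulus below 1 because 0 < a ≤ 1.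
  obtain ⟨ε, hε, hεp⟩ : ∃ ε > 0, ∀ y : ℂ, ‖y‖ < ε → ‖1 - (y - a) ^ 2‖ ≤ 1 := by
    have hc : ContinuousAt (fun y : ℂ => ‖1 - (y - a) ^ 2‖) 0 := by fun_prop
    have h0 : ‖1 - ((0 : ℂ) - a) ^ 2‖ < 1 := by
      have : 1 - ((0 : ℂ) - a) ^ 2 = ((1 - a ^ 2 : ℝ) : ℂ) := by push_cast; ring
      rw [this, Complex.norm_real, Real.norm_eq_abs, abs_lt]
      have := hre i
      constructor <;> nlinarith
    obtain ⟨ε, hε, h⟩ := Metric.eventually_nhds_iff.1 (hc.eventually_lt continuousAt_const h0)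
    exact ⟨ε, hε, fun y hy => (h (by simpa using hy)).le⟩
  have hfin : {j | ε ≤ ‖x j‖}.Finite := by
    have := hs.norm.tendsto_cofinite_zero.eventually (gt_mem_nhds hε)
    simpa [Filter.eventually_cofinite] using this
  have hxi : 0 < ‖x i‖ := norm_pos_iff.2 fun h => by
    have := hre i; rw [h] at this; simp at this
  have hEfin : {j | x j = x i}.Finite := by
    have := hs.norm.tendsto_cofinite_zero.eventually (gt_mem_nhds hxi)
    rw [Filter.eventually_cofinite] at this
    exact this.subset fun j hj => by simp [show x j = x i from hj]
  classical
  -- `r` kills the nodes of modulus at least ε other than x i, where p could be large.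
  set J : Finset ℕ := hfin.toFinset.filter fun j => x j ≠ x i with hJ
  set r : ℂ[X] := ∏ j ∈ J, (X - C (x j)) with hr
  have hri : r.eval (x i) ≠ 0 := by
    rw [hr, eval_prod, Finset.prod_ne_zero_iff]
    intro j hj
    simpa [sub_eq_zero, eq_comm] using (Finset.mem_filter.1 hj).2
  have hrj : ∀ j, ε ≤ ‖x j‖ → x j ≠ x i → r.eval (x j) = 0 := by
    intro j h1 h2
    rw [hr, eval_prod]
    exact Finset.prod_eq_zero (i := j) (by simp [hJ, h1, h2]) (by simp)
  obtain ⟨C, hC0, hC⟩ := exists_norm_functional_mul_pow_le hs hx hpos' hbd r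
  obtain ⟨B, hB0, hB⟩ := exists_norm_eval_le r
  -- Indices sharing the value x i contribute identical terms, so they reinforce and cannot cancel.
  set m := hEfin.toFinset.card with hm
  have hm1 : 1 ≤ m := Finset.card_pos.2 ⟨i, by simp⟩
  set D := ∑' j, ‖x j‖ ^ 2 * B
  have hmain : ∀ N : ℕ, ‖x i ^ 2 * r.eval (x i)‖ * (1 + b ^ 2) ^ N ≤ (C + D) * A ^ N := by
    intro N
    set t : ℕ → ℂ := fun j => x j ^ 2 * (r * mapAlg ℝ ℂ p ^ N).eval (x j) with ht
    set e : ℕ → ℂ := fun j => if j ∈ hEfin.toFinset then t i else 0 with he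
    have hts : Summable t := summable_eval hs hx _
    have hes : Summable e := summable_of_ne_finset_zero (s := hEfin.toFinset) fun j hj => by
      simp only [he, if_neg hj]
    have hesum : ∑' j, e j = m * t i := by
      rw [tsum_eq_sum (s := hEfin.toFinset) fun j hj => by simp only [he, if_neg hj]]
      simp only [he]
      rw [Finset.sum_ite_mem, Finset.inter_self, Finset.sum_const, nsmul_eq_mul]
    have hrest : ∀ j, ‖t j - e j‖ ≤ ‖x j‖ ^ 2 * B := by
      intro j
      by_cases hj : x j = x i
      · have : t j - e j = 0 := by simp [he, ht, hj]
        rw [this, norm_zero]; positivity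
      · have : e j = 0 := by simp [he, hj]
        rw [this, sub_zero, ht]
        simp only [eval_mul, eval_pow, hpe, norm_mul, norm_pow]
        refine mul_le_mul_of_nonneg_left ?_ (by positivity)
        by_cases hj' : ε ≤ ‖x j‖
        · rw [hrj j hj' hj]; simpa using hB0
        · exact (mul_le_of_le_one_right (norm_nonneg _)
            (pow_le_one₀ (norm_nonneg _) (hεp _ (not_le.1 hj')))).trans (hB _ (hx j))
    have hD : ‖∑' j, t j - m * t i‖ ≤ D := by
      rw [← hesum, ← hts.tsum_sub hes]
      exact tsum_of_norm_bounded ((summable_norm_sq hs hx).mul_right B).hasSum hrest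
    have hti : ‖t i‖ = ‖x i ^ 2 * r.eval (x i)‖ * (1 + b ^ 2) ^ N := by
      simp only [ht, eval_mul, eval_pow, hpe, hpi]
      rw [← mul_assoc, norm_mul, norm_pow (_ : ℂ) N, Complex.norm_real,
        Real.norm_of_nonneg (by positivity)]
    have hCN := hC N
    rw [functional_apply] at hCN
    have h1 : ‖(m : ℂ) * t i‖ ≤ C * A ^ N + D := by
      have := norm_sub_norm_le ((m : ℂ) * t i) (∑' j, t j)
      rw [norm_sub_rev] at this
      have hCN' : ‖∑' j, t j‖ ≤ C * A ^ N := hCN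
      linarith
    have hD0 : 0 ≤ D := (norm_nonneg _).trans hD
    have h2 : D ≤ D * A ^ N := le_mul_of_one_le_right hD0 (one_le_pow₀ hA1)
    have h3 : ‖t i‖ ≤ ‖(m : ℂ) * t i‖ := by
      rw [norm_mul (m : ℂ), Complex.norm_natCast]
      exact le_mul_of_one_le_left (norm_nonneg _) (by exact_mod_cast hm1)
    rw [← hti, add_mul]
    linarith
  have hc0 : 0 < ‖x i ^ 2 * r.eval (x i)‖ :=
    norm_pos_iff.2 (mul_ne_zero (pow_ne_zero _ (norm_pos_iff.1 hxi)) hri)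
  have hA0 : 0 < A := by linarith
  obtain ⟨N, hN⟩ := pow_unbounded_of_one_lt ((C + D) / ‖x i ^ 2 * r.eval (x i)‖)
    ((one_lt_div hA0).2 hAb)
  rw [div_pow, div_lt_div_iff₀ hc0 (by positivity)] at hN
  linarith [hmain N]

end SquareWeightedSum

/-! ### Power sums of reciprocal roots -/

section RootSums

variable {h : ℂ → ℂ} {z : ℕ → ℂ}

theorem exists_root_of_eq_zero (hh : Differentiable ℂ h) (hz : ListsNonzeroRoots h z) {w : ℂ}
    (hw : w ≠ 0) (h0 : h w = 0) : ∃ n, z n = w ∨ -z n = w := by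
  by_contra! hne
  have h1 : {n | z n = w} = ∅ := Set.eq_empty_of_forall_notMem fun n hn => (hne n).1 hn
  have h2 : {n | -z n = w} = ∅ := Set.eq_empty_of_forall_notMem fun n hn => (hne n).2 hn
  have := hz w hw
  rw [h1, h2, Set.encard_empty, add_zero, (hh.analyticAt w).analyticOrderAt_eq_zero] at this
  exact this h0

theorem analyticOrderAt_ne_top_of_apply_ne_zero (hh : Differentiable ℂ h) (h0 : h 0 ≠ 0) (w : ℂ) :
    analyticOrderAt h w ≠ ⊤ := by
  rw [Ne, AnalyticOnNhd.analyticOrderAt_eq_top_iff_eq_zero w fun z => hh.analyticAt z]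
  rintro rfl
  exact h0 rfl

/-- Zeros do not accumulate, and each is listed finitely often because its order is finite. -/
theorem finite_setOf_norm_root_le (hh : Differentiable ℂ h) (h0 : h 0 ≠ 0)
    (hz : ListsNonzeroRoots h z) (hz0 : ∀ n, z n ≠ 0) (R : ℝ) : {n | ‖z n‖ ≤ R}.Finite := by
  have hzeros : {w : ℂ | ‖w‖ ≤ R ∧ h w = 0}.Finite := by
    by_contra hinf
    obtain ⟨w, -, hw⟩ := Set.Infinite.exists_accPt_of_subset_isCompact hinf
      (isCompact_closedBall (0 : ℂ) R) fun w hw => by simpa using hw.1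
    have hfr : ∃ᶠ u in nhdsWithin w {w}ᶜ, h u = 0 :=
      (accPt_iff_frequently_nhdsNE.1 hw).mono fun u hu => hu.2
    have := AnalyticOnNhd.eqOn_zero_of_preconnected_of_frequently_eq_zero (U := Set.univ)
      (fun u _ => hh.analyticAt u) isPreconnected_univ (Set.mem_univ w) hfr
    exact h0 (this (Set.mem_univ 0))
  refine Set.Finite.of_finite_fibers z (hzeros.subset ?_) fun w hw => ?_
  · rintro _ ⟨n, hn, rfl⟩
    refine ⟨hn, ?_⟩
    by_contra hne
    have := hz _ (hz0 n)
    rw [(hh.analyticAt _).analyticOrderAt_eq_zero.2 hne, eq_comm, add_eq_zero,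
      Set.encard_eq_zero] at this
    exact Set.notMem_empty n (this.1 ▸ rfl)
  · obtain ⟨n, hn, rfl⟩ := hw
    have h1 := analyticOrderAt_ne_top_of_apply_ne_zero hh h0 (z n)
    rw [hz _ (hz0 n)] at h1
    have h2 := Set.encard_ne_top_iff.1 (WithTop.add_ne_top.1 h1).1
    exact h2.subset fun m hm => hm.2

theorem one_le_norm_rootFactor {c w : ℂ} (hc : c ≠ 0) (h : 2 * ‖c‖ ≤ ‖w‖) :
    1 ≤ ‖rootFactor c w‖ := by
  have hc' : 0 < ‖c‖ := norm_pos_iff.2 hc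
  have h2 : 2 ≤ ‖w / c‖ := by rwa [norm_div, le_div_iff₀ hc']
  have e1 : 1 ≤ ‖1 - w / c‖ := by
    have := norm_sub_norm_le (w / c) 1
    rw [norm_sub_rev, norm_one] at this; linarith
  have e2 : 1 ≤ ‖1 + w / c‖ := by
    have := norm_sub_norm_le (w / c) (-1)
    rw [sub_neg_eq_add, norm_neg, norm_one, add_comm] at this; linarith
  rw [rootFactor, norm_mul]
  exact one_le_mul_of_one_le_of_one_le e1 e2

/-- Dividing out the roots in a disc of radius `R` leaves a zero-free function there, with
logarithmic derivative controlled by the growth of `h`. -/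
theorem norm_iteratedDeriv_logDeriv_add_sum_le (hh : Differentiable ℂ h) (h0 : h 0 ≠ 0)
    (hz : ListsNonzeroRoots h z) (hz0 : ∀ n, z n ≠ 0) {R A : ℝ} (hR : 0 < R) (hA : 0 < A)
    (hgrow : ∀ w : ℂ, ‖w‖ = 2 * R → ‖h w‖ ≤ Real.exp A * ‖h 0‖) (k : ℕ) :
    ‖iteratedDeriv (2 * k + 1) (logDeriv h) 0 + 2 * (2 * k + 1).factorial *
      ∑ j ∈ (finite_setOf_norm_root_le hh h0 hz hz0 R).toFinset, 1 / z j ^ (2 * k + 2)‖ ≤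
      (2 * k + 2).factorial * (2 * A) / (R / 2) ^ (2 * k + 2) := by
  set S := (finite_setOf_norm_root_le hh h0 hz hz0 R).toFinset with hS
  have hSmem : ∀ n, n ∈ S ↔ ‖z n‖ ≤ R := by simp [hS]
  obtain ⟨f, hf, hfh⟩ := exists_eq_mul_prod_rootFactor hh hz0 hz S
  have hPd : Differentiable ℂ fun u => ∏ j ∈ S, rootFactor (z j) u :=
    Differentiable.fun_finsetProd fun i _ => differentiable_rootFactor _
  have hP0 : ∀ j, rootFactor (z j) 0 = 1 := by simp [rootFactor]
  have hf0 : f 0 = h 0 := by simp [hfh 0, hP0]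
  -- Every index listing such a w or -w lies in `S`, so the product already carries the full order
  -- of `h` at w.
  have hfne : ∀ w ∈ Metric.ball (0 : ℂ) R, f w ≠ 0 := by
    intro w hw
    rcases eq_or_ne w 0 with rfl | hw0
    · rwa [hf0]
    have hwR : ‖w‖ ≤ R := (mem_ball_zero_iff.1 hw).le
    have e1 := hz w hw0
    have e2 : analyticOrderAt h w = analyticOrderAt f w +
        analyticOrderAt (fun u => ∏ j ∈ S, rootFactor (z j) u) w := by
      rw [← analyticOrderAt_mul (hf.analyticAt _) (hPd.analyticAt _)]
      congr 1
      ext u; exact hfh u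
    have e3 : {n ∈ (S : Set ℕ) | z n = w} = {n | z n = w} := by
      ext n
      simp only [Finset.mem_coe, hSmem, Set.mem_ofPred_eq, and_iff_right_iff_imp]
      rintro rfl; exact hwR
    have e4 : {n ∈ (S : Set ℕ) | -z n = w} = {n | -z n = w} := by
      ext n
      simp only [Finset.mem_coe, hSmem, Set.mem_ofPred_eq, and_iff_right_iff_imp]
      rintro rfl; simpa using hwR
    have htop := analyticOrderAt_ne_top_of_apply_ne_zero hh h0 w
    rw [analyticOrderAt_prod_rootFactor hz0, e3, e4, ← e1] at e2
    have e5 : analyticOrderAt f w = 0 := by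
      refine ENat.add_left_injective_of_ne_top htop ?_
      simpa using e2.symm
    exact (hf.analyticAt w).analyticOrderAt_eq_zero.1 e5
  have hfb : ∀ w ∈ Metric.ball (0 : ℂ) R, ‖f w‖ ≤ Real.exp A * ‖f 0‖ := by
    intro w hw
    rw [hf0]
    refine Complex.norm_le_of_forall_mem_frontier_norm_le (U := Metric.ball 0 (2 * R))
      Metric.isBounded_ball hf.diffContOnCl (fun u hu => ?_) (subset_closure ?_)
    · rw [frontier_ball _ (by positivity), mem_sphere_zero_iff_norm] at hu
      refine le_trans ?_ (hgrow u hu)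
      rw [hfh u, norm_mul, norm_prod]
      refine le_mul_of_one_le_right (norm_nonneg _) (Finset.one_le_prod fun j hj => ?_)
      refine one_le_norm_rootFactor (hz0 j) ?_
      rw [hu]
      linarith [(hSmem j).1 hj]
    · exact Metric.ball_subset_ball (by linarith) hw
  have hbound := norm_iteratedDeriv_logDeriv_le hA hR hf.differentiableOn hfne hfb (2 * k + 1)
  have hlogan : ∀ {u : ℂ → ℂ}, Differentiable ℂ u → u 0 ≠ 0 →
      ContDiffAt ℂ (2 * k + 1 : ℕ) (logDeriv u) 0 := fun {u} hu hu0 =>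
    ((hu.analyticAt 0).deriv.div (hu.analyticAt 0) hu0).contDiffAt
  have hrf : ∀ j, ContDiffAt ℂ (2 * k + 1 : ℕ) (logDeriv (rootFactor (z j))) 0 := fun j =>
    hlogan (differentiable_rootFactor _) (by simp [hP0])
  have hev : logDeriv h =ᶠ[nhds 0]
      fun w => logDeriv f w + ∑ j ∈ S, logDeriv (rootFactor (z j)) w := by
    have hnear : ∀ᶠ w in nhds (0 : ℂ), ∀ j ∈ S, rootFactor (z j) w ≠ 0 := by
      rw [Filter.eventually_all_finset]
      intro j _
      exact (differentiable_rootFactor (z j)).continuous.continuousAt.eventually_ne (by simp [hP0])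
    filter_upwards [hnear, hf.continuous.continuousAt.eventually_ne (hf0 ▸ h0)] with w h1 h2
    have e : h = fun w => f w * ∏ j ∈ S, rootFactor (z j) w := funext hfh
    rw [e, logDeriv_mul w h2 (Finset.prod_ne_zero_iff.2 h1) (hf w) (hPd w),
      logDeriv_prod h1 fun j _ => differentiable_rootFactor _ _]
  rw [hev.iteratedDeriv_eq, iteratedDeriv_fun_add (hlogan hf (hf0 ▸ h0))
    (ContDiffAt.sum fun j _ => hrf j), iteratedDeriv_fun_sum fun j _ => hrf j,
    Finset.sum_congr rfl fun j _ => iteratedDeriv_logDeriv_rootFactor (hz0 j) k,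
    ← Finset.mul_sum]
  convert hbound using 2
  ring

/-- The power sums of the reciprocals of the roots, over growing discs, converge to Taylor
coefficients of the logarithmic derivative. -/
theorem tendsto_sum_one_div_root_pow (hh : Differentiable ℂ h) (h0 : h 0 ≠ 0)
    (hz : ListsNonzeroRoots h z) (hz0 : ∀ n, z n ≠ 0) {ρ C r : ℝ} (hρ : ρ < 2)
    (hgrow : ∀ w : ℂ, r ≤ ‖w‖ → ‖h w‖ ≤ C * Real.exp (‖w‖ ^ ρ)) (k : ℕ) :
    Filter.Tendsto (fun R : ℕ =>
      ∑ j ∈ (finite_setOf_norm_root_le hh h0 hz hz0 R).toFinset, 1 / z j ^ (2 * k + 2))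
      Filter.atTop (nhds (-(1 / (((2 * k + 1).factorial : ℂ) * 2)) *
        iteratedDeriv (2 * k + 1) (logDeriv h) 0)) := by
  -- Absorbs `C` into the exponent, giving A = D + (2R)^ρ in the disc estimate.
  obtain ⟨D, hD0, hD⟩ : ∃ D : ℝ, 0 < D ∧ C ≤ Real.exp D * ‖h 0‖ := by
    have h0' : 0 < ‖h 0‖ := norm_pos_iff.2 h0
    refine ⟨|C| / ‖h 0‖ + 1, by positivity, ?_⟩
    have := Real.add_one_le_exp (|C| / ‖h 0‖ + 1)
    calc C ≤ |C| / ‖h 0‖ * ‖h 0‖ := by rw [div_mul_cancel₀ _ h0'.ne']; exact le_abs_self C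
      _ ≤ _ := by gcongr; linarith
  set q := iteratedDeriv (2 * k + 1) (logDeriv h) 0
  set S : ℕ → ℂ := fun R =>
    ∑ j ∈ (finite_setOf_norm_root_le hh h0 hz hz0 R).toFinset, 1 / z j ^ (2 * k + 2)
  have hlim : Filter.Tendsto (fun R : ℕ => q + 2 * (2 * k + 1).factorial * S R)
      Filter.atTop (nhds 0) := by
    refine squeeze_zero_norm' (a := fun R : ℕ => (2 * k + 2).factorial *
      (2 * (D + (2 * R) ^ ρ)) / (R / 2) ^ (2 * k + 2)) ?_ ?_
    · filter_upwards [Filter.eventually_ge_atTop 1, Filter.eventually_ge_atTop ⌈r⌉₊] with R h1 hr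
      have h1' : (1 : ℝ) ≤ R := by exact_mod_cast h1
      have hr' : r ≤ R := Nat.ceil_le.1 hr
      refine norm_iteratedDeriv_logDeriv_add_sum_le hh h0 hz hz0 (by linarith) (by positivity)
        (fun w hw => ?_) k
      refine (hgrow w (by rw [hw]; linarith)).trans ?_
      rw [hw, Real.exp_add, mul_right_comm]
      gcongr
    · have hp : ∀ s : ℝ, s < (2 * k + 2 : ℕ) →
          Filter.Tendsto (fun R : ℕ => (R : ℝ) ^ s / (R : ℝ) ^ (2 * k + 2)) Filter.atTop
            (nhds 0) := by
        intro s hs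
        have := (tendsto_rpow_neg_atTop (sub_pos.2 hs)).comp (tendsto_natCast_atTop_atTop (R := ℝ))
        refine this.congr' ?_
        filter_upwards [Filter.eventually_gt_atTop 0] with R hR
        have hR' : (0 : ℝ) < R := by exact_mod_cast hR
        rw [Function.comp_apply, neg_sub, Real.rpow_sub hR', Real.rpow_natCast]
      have e0 := hp 0 (by positivity)
      have e1 := hp ρ (hρ.trans_le (by push_cast; nlinarith [k.zero_le]))
      have := ((e0.const_mul ((2 * k + 2).factorial * 2 * D * 2 ^ (2 * k + 2))).add
        (e1.const_mul ((2 * k + 2).factorial * 2 * (2 : ℝ) ^ ρ * 2 ^ (2 * k + 2))))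
      simp only [mul_zero, add_zero] at this
      refine this.congr fun R => ?_
      rw [Real.mul_rpow (by norm_num) R.cast_nonneg, Real.rpow_zero, div_pow, div_div_eq_mul_div]
      ring
  have hfac : ((2 * k + 1).factorial : ℂ) ≠ 0 := by exact_mod_cast (Nat.factorial_ne_zero _)
  have := (hlim.sub_const q).const_mul (1 / (((2 * k + 1).factorial : ℂ) * 2))
  convert this using 1
  · ext R
    rw [add_sub_cancel_left]
    field_simp
  · congr 1; ring

/-- The disc sums converge and their terms have positive real part, so the real parts are summable.
They dominate the norms, since |z²| = Re z² + 2 (Im z)² ≤ (1 + 2M²) Re z². -/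
theorem summable_one_div_root_sq {M : ℝ} (hh : Differentiable ℂ h) (h0 : h 0 ≠ 0)
    (hz : ListsNonzeroRoots h z) (hz0 : ∀ n, z n ≠ 0) {ρ C r : ℝ} (hρ : ρ < 2)
    (hgrow : ∀ w : ℂ, r ≤ ‖w‖ → ‖h w‖ ≤ C * Real.exp (‖w‖ ^ ρ))
    (hz_sq : ∀ n : ℕ, 1 < (z n ^ 2).re) (hz_im : ∀ n : ℕ, |(z n).im| ≤ M) :
    Summable fun n => 1 / z n ^ 2 := by
  have hlim := tendsto_sum_one_div_root_pow hh h0 hz hz0 hρ hgrow 0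
  set S : ℕ → Finset ℕ := fun R => (finite_setOf_norm_root_le hh h0 hz hz0 R).toFinset with hS
  have hlim' := (Complex.continuous_re.tendsto _).comp hlim
  set c := (-(1 / (((2 * 0 + 1).factorial : ℂ) * 2)) *
        iteratedDeriv (2 * 0 + 1) (logDeriv h) 0).re
  have hre : ∀ n, (1 / z n ^ 2).re = (z n ^ 2).re / ‖z n ^ 2‖ ^ 2 := by
    intro n; rw [one_div, Complex.inv_re, Complex.normSq_eq_norm_sq]
  have hre0 : ∀ n, 0 ≤ (1 / z n ^ 2).re := by
    intro n; rw [hre]; have := hz_sq n; positivity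
  have hmono : Monotone S := by
    intro R R' hRR n hn
    simp only [hS, Set.Finite.mem_toFinset, Set.mem_ofPred_eq] at hn ⊢
    exact hn.trans (by exact_mod_cast hRR)
  have hsum : Monotone fun R : ℕ => ∑ j ∈ S R, (1 / z j ^ 2).re := fun R R' hRR =>
    Finset.sum_le_sum_of_subset_of_nonneg (hmono hRR) fun j _ _ => hre0 j
  have hcover : ∀ n, ∃ R, n ∈ S R := fun n => by
    obtain ⟨R, hR⟩ := exists_nat_ge ‖z n‖
    exact ⟨R, by simpa [hS] using hR⟩
  have hS' := Filter.tendsto_atTop_finset_of_monotone hmono hcover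
  have hle : ∀ R, ∑ j ∈ S R, (1 / z j ^ 2).re ≤ c := by
    refine hsum.ge_of_tendsto ?_
    simpa [Function.comp_def, Complex.re_sum] using hlim'
  have hsre : Summable fun n => (1 / z n ^ 2).re := by
    refine summable_of_sum_le hre0 (c := c) fun u => ?_
    obtain ⟨R, hR⟩ := (hS'.eventually (Filter.eventually_ge_atTop u)).exists
    exact (Finset.sum_le_sum_of_subset_of_nonneg hR fun j _ _ => hre0 j).trans (hle R)
  refine Summable.of_norm_bounded (hsre.mul_left (1 + 2 * M ^ 2)) fun n => ?_
  have h1 := hz_sq n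
  have hpos : 0 < ‖z n ^ 2‖ := norm_pos_iff.2 (pow_ne_zero _ (hz0 n))
  have h2 : ‖z n ^ 2‖ ≤ (1 + 2 * M ^ 2) * (z n ^ 2).re := by
    have h3 : ‖z n ^ 2‖ = (z n ^ 2).re + 2 * (z n).im ^ 2 := by
      rw [norm_pow, ← Complex.normSq_eq_norm_sq, Complex.normSq_apply, pow_two (z n),
        Complex.mul_re]; ring
    have h4 : (z n).im ^ 2 ≤ M ^ 2 := sq_le_sq' (neg_le_of_abs_le (hz_im n)) (le_of_abs_le (hz_im n))
    rw [h3]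
    nlinarith [sq_nonneg M]
  rw [hre, norm_div, norm_one, ← mul_div_assoc, div_le_div_iff₀ hpos (by positivity)]
  nlinarith

theorem hasSum_one_div_root_pow {M : ℝ} (hh : Differentiable ℂ h) (h0 : h 0 ≠ 0)
    (hz : ListsNonzeroRoots h z) (hz0 : ∀ n, z n ≠ 0) {ρ C r : ℝ} (hρ : ρ < 2)
    (hgrow : ∀ w : ℂ, r ≤ ‖w‖ → ‖h w‖ ≤ C * Real.exp (‖w‖ ^ ρ))
    (hz_sq : ∀ n : ℕ, 1 < (z n ^ 2).re) (hz_im : ∀ n : ℕ, |(z n).im| ≤ M) (k : ℕ) :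
    HasSum (fun n => 1 / z n ^ (2 * k + 4)) (logDerivMoment h k) := by
  have hs := summable_one_div_root_sq hh h0 hz hz0 hρ hgrow hz_sq hz_im
  have hle1 : ∀ n, ‖1 / z n ^ 2‖ ≤ 1 := by
    intro n
    rw [norm_div, norm_one]
    exact div_le_one_of_le₀ ((hz_sq n).le.trans (Complex.re_le_norm _)) (norm_nonneg _)
  have hs' : Summable fun n => 1 / z n ^ (2 * k + 4) := by
    refine Summable.of_norm_bounded hs.norm fun n => ?_
    have : 1 / z n ^ (2 * k + 4) = (1 / z n ^ 2) * (1 / z n ^ 2) ^ (k + 1) := by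
      rw [one_div_pow, ← pow_mul, one_div_mul_one_div, ← pow_add]; ring_nf
    rw [this, norm_mul, norm_pow]
    exact mul_le_of_le_one_right (norm_nonneg _) (pow_le_one₀ (norm_nonneg _) (hle1 n))
  -- The shift to k+1 matches the derivative order 2k+3 = 2(k+1)+1.
  have hlim := tendsto_sum_one_div_root_pow hh h0 hz hz0 hρ hgrow (k + 1)
  have hmono : Monotone fun R : ℕ => (finite_setOf_norm_root_le hh h0 hz hz0 R).toFinset := by
    intro R R' hRR n hn
    simp only [Set.Finite.mem_toFinset, Set.mem_ofPred_eq] at hn ⊢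
    exact hn.trans (by exact_mod_cast hRR)
  have hS' := Filter.tendsto_atTop_finset_of_monotone hmono fun n => by
    obtain ⟨R, hR⟩ := exists_nat_ge ‖z n‖
    exact ⟨R, by simpa using hR⟩
  have := hs'.hasSum.comp hS'
  have heq := tendsto_nhds_unique this hlim
  rw [logDerivMoment]
  convert hs'.hasSum using 1
  exact heq.symm

end RootSums

/-! ### The even power series and the final equivalence -/

section EvenSeries

variable {a : ℕ → ℂ}

theorem differentiable_evenSeries (ha : ∀ w : ℂ, w ≠ 0 → Summable fun n => a n * (-w ^ 2) ^ n) :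
    Differentiable ℂ (evenSeries a) := by
  intro w
  have hr : (0 : ℝ) < ‖w‖ + 1 := by positivity
  have hd : DifferentiableOn ℂ (evenSeries a) (Metric.ball 0 (‖w‖ + 1)) := by
    refine Complex.differentiableOn_tsum_of_summable_norm
      (ha ((‖w‖ + 1 : ℝ) : ℂ) (by exact_mod_cast hr.ne')).norm
      (fun n => by fun_prop) Metric.isOpen_ball fun n u hu => ?_
    have hu' : ‖u‖ ≤ ‖w‖ + 1 := (mem_ball_zero_iff.1 hu).le
    simp only [norm_mul, norm_pow, norm_neg, Complex.norm_real, Real.norm_of_nonneg hr.le]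
    gcongr
  exact hd.differentiableAt (Metric.isOpen_ball.mem_nhds (by simp))

theorem evenSeries_zero : evenSeries a 0 = a 0 := by
  rw [evenSeries, tsum_eq_single 0 fun n hn => by simp [hn]]
  simp

end EvenSeries

theorem exists_growth_of_entireOrder_lt_two {g : ℂ → ℂ} (hg : entireOrder g < 2) :
    ∃ ρ C r : ℝ, ρ < 2 ∧ ∀ w : ℂ, r ≤ ‖w‖ → ‖g w‖ ≤ C * Real.exp (‖w‖ ^ ρ) := by
  rw [entireOrder] at hg
  simp only [iInf_lt_iff] at hg
  obtain ⟨ρ, hO, hρ⟩ := hg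
  obtain ⟨C, hC⟩ := hO.bound
  rw [← comap_norm_atTop, Filter.eventually_comap, Filter.eventually_atTop] at hC
  obtain ⟨r, hr⟩ := hC
  refine ⟨ρ, C, r, by exact_mod_cast hρ, fun w hw => ?_⟩
  simpa [abs_of_pos (Real.exp_pos _)] using hr _ hw w rfl

/-- Multiplying the terms by 1 - x_j replaces m_n by m_n - m_(n+1), which is -Δ. -/
theorem hasSum_iterate_fwdDiff {x : ℕ → ℂ} {m : ℕ → ℂ}
    (hm : ∀ n, HasSum (fun j => x j ^ (n + 2)) (m n)) (n k : ℕ) :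
    HasSum (fun j => x j ^ (n + 2) * (1 - x j) ^ k) ((-1) ^ k * (fwdDiff (1 : ℕ))^[k] m n) := by
  induction k generalizing n with
  | zero => simpa using hm n
  | succ k ih =>
    have hstep := (ih n).sub (ih (n + 1))
    rw [← mul_sub, ← neg_sub ((fwdDiff (1 : ℕ))^[k] m (n + 1)), mul_neg, ← neg_one_mul, ← mul_assoc,
      ← pow_succ'] at hstep
    rw [Function.iterate_succ_apply', fwdDiff]
    refine hstep.congr_fun fun j => ?_
    ring

theorem corollary4 (μ : ℕ) (g : ℂ → ℂ) (a : ℕ → ℂ) (z : ℕ → ℂ) (M : ℝ)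
    (hg : Differentiable ℂ g) (hg_even : Function.Even g) (hg_order : entireOrder g < 2)
    (hg_series : ∀ w : ℂ, w ≠ 0 →
      HasSum (fun n : ℕ => a n * (-w ^ 2) ^ n) (g w / w ^ (2 * μ)))
    (ha : ∀ n : ℕ, 1 ≤ n → 0 < a 0 * a n)
    (hz : ListsNonzeroRoots g z)
    (hz_re : ∀ n : ℕ, 0 < (z n).re)
    (hz_sq : ∀ n : ℕ, 1 < (z n ^ 2).re)
    (hM : 0 < M) (hz_im : ∀ n : ℕ, |(z n).im| ≤ M) :
    (∀ k : ℕ, HasSum (fun n : ℕ => 1 / z n ^ (2 * k + 4)) (logDerivMoment (evenSeries a) k)) ∧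
    (∀ n k : ℕ, HasSum (fun j : ℕ => 1 / (z j ^ 2) ^ (n + 2) * (1 - 1 / z j ^ 2) ^ k)
      ((-1) ^ k * (fwdDiff (1 : ℕ))^[k] (logDerivMoment (evenSeries a)) n)) ∧
    ((∀ w : ℂ, w ≠ 0 → g w = 0 → w.im = 0) ↔
      HausdorffConditions (logDerivMoment (evenSeries a))) := by
  have hz0 : ∀ n, z n ≠ 0 := fun n h => by simpa [h] using hz_re n
  have hd := differentiable_evenSeries fun w hw => (hg_series w hw).summable
  have h0 : evenSeries a 0 ≠ 0 := by
    rw [evenSeries_zero]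
    rintro h
    simpa [h] using ha 1 le_rfl
  have hgh : ∀ w : ℂ, w ≠ 0 → evenSeries a w = g w / w ^ (2 * μ) := fun w hw =>
    (hg_series w hw).tsum_eq
  have hzh : ListsNonzeroRoots (evenSeries a) z := by
    intro w hw
    have hpow : analyticOrderAt (fun u : ℂ => u ^ (2 * μ)) w = 0 :=
      AnalyticAt.analyticOrderAt_eq_zero (by fun_prop) |>.2 (pow_ne_zero _ hw)
    have hev : g =ᶠ[nhds w] evenSeries a * fun u : ℂ => u ^ (2 * μ) := by
      filter_upwards [isOpen_ne.mem_nhds hw] with u hu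
      rw [Pi.mul_apply, hgh u hu, div_mul_cancel₀ _ (pow_ne_zero _ hu)]
    rw [← hz w hw, analyticOrderAt_congr hev, analyticOrderAt_mul (hd.analyticAt w) (by fun_prop),
      hpow, add_zero]
  obtain ⟨ρ, C, r, hρ, hgrow⟩ := exists_growth_of_entireOrder_lt_two hg_order
  -- For |w| ≥ 1, dividing by w^(2μ) does not increase the modulus.
  have hgrow' : ∀ w : ℂ, max r 1 ≤ ‖w‖ → ‖evenSeries a w‖ ≤ C * Real.exp (‖w‖ ^ ρ) := by
    intro w hw
    have hw1 : 1 ≤ ‖w‖ := (le_max_right _ _).trans hw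
    rw [hgh w (norm_pos_iff.1 (by linarith)), norm_div, norm_pow]
    exact (div_le_self (norm_nonneg _) (one_le_pow₀ hw1)).trans
      (hgrow w ((le_max_left _ _).trans hw))
  have hs := summable_one_div_root_sq hd h0 hzh hz0 hρ hgrow' hz_sq hz_im
  have hmom := hasSum_one_div_root_pow hd h0 hzh hz0 hρ hgrow' hz_sq hz_im
  have hdiff : ∀ n k : ℕ, HasSum (fun j => (1 / z j ^ 2) ^ (n + 2) * (1 - 1 / z j ^ 2) ^ k)
      ((-1) ^ k * (fwdDiff (1 : ℕ))^[k] (logDerivMoment (evenSeries a)) n) :=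
    hasSum_iterate_fwdDiff fun n => by
      convert hmom n using 2 with j
      rw [one_div_pow, ← pow_mul]; ring_nf
  refine ⟨hmom, fun n k => by simpa only [one_div_pow] using hdiff n k, fun hreal n k => ?_,
    fun hH w hw hgw => ?_⟩
  · refine (hdiff n k).nonneg fun j => ?_
    have hgz : g (z j) = 0 := by
      by_contra hne
      have := hz _ (hz0 j)
      rw [(hg.analyticAt _).analyticOrderAt_eq_zero.2 hne, eq_comm, add_eq_zero,
        Set.encard_eq_zero] at this
      exact Set.notMem_empty j (this.1 ▸ rfl)
    have him := hreal _ (hz0 j) hgz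
    obtain ⟨t, ht⟩ : ∃ t : ℝ, z j = t := ⟨(z j).re, Complex.ext rfl (by simpa using him)⟩
    have hsq := hz_sq j
    rw [ht, ← Complex.ofReal_pow, Complex.ofReal_re] at hsq
    have h1 : (0 : ℝ) ≤ 1 - 1 / t ^ 2 := sub_nonneg.2 (div_le_one_of_le₀ hsq.le (by positivity))
    have h2 : (0 : ℝ) ≤ (1 / t ^ 2) ^ (n + 2) * (1 - 1 / t ^ 2) ^ k := by positivity
    rw [ht]
    exact_mod_cast h2
  · have hx := SquareWeightedSum.im_eq_zero hs
      (fun j => by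
        rw [norm_div, norm_one]
        exact div_le_one_of_le₀ ((hz_sq j).le.trans (Complex.re_le_norm _)) (norm_nonneg _))
      (fun j => by
        rw [one_div, Complex.inv_re]
        exact div_pos (by linarith [hz_sq j]) (Complex.normSq_pos.2 (pow_ne_zero _ (hz0 j))))
      (fun n k => by rw [(hdiff n k).tsum_eq]; exact hH n k)
    -- Real 1/z² gives 2 Re z Im z = 0, and Re z > 0 excludes the imaginary axis.
    have him : ∀ j, (z j).im = 0 := by
      intro j
      have h1 := hx j
      rw [one_div, Complex.inv_im, div_eq_zero_iff, neg_eq_zero, pow_two, Complex.mul_im] at h1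
      rcases h1 with h1 | h1
      · have : 2 * (z j).re * (z j).im = 0 := by linarith
        simpa [(hz_re j).ne'] using this
      · exact absurd (Complex.normSq_eq_zero.1 h1) (mul_ne_zero (hz0 j) (hz0 j))
    obtain ⟨n, rfl | rfl⟩ := exists_root_of_eq_zero hg hz hw hgw
    · exact him n
    · simp [him n]
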